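/- Let $(\varphi_e)_{e\in\omega}$ be a standard listing of the partial computable functions, and let $\mathbf d$ be a Turing degree (of a set $D\subseteq\omega$). A tree is a set $T\subseteq\omega^{<\omega}$ closed under initial segments; $n$ is an index of the computable tree $T$ if $\varphi_n$ is the characteristic function of $T$ (finite sequences being coded by natural numbers). A path through $T$ is a function $p\in\omega^\omega$ all of whose finite initial segments lie in $T$, and $T$ is ill founded if it has a path. The degree $\mathbf d$ is *loquaciously high for paths* if there is a total $\mathbf d$-computable function $F:\omega\to\omega^\omega$ (that is, $(n,x)\mapsto F(n)(x)$ is total and $\mathbf d$-computable) such that, for every $n$ that is an index of an ill-founded computable tree $T$, $F(n)$ is a path through $T$. A computable structure is a structure $\mathcal M$ with universe a computable subset of $\omega$, in a computable first-order language (whose symbols are natural numbers, their kind and arity being computable), whose basic functions and relations are computable uniformly in the symbol; an index of $\mathcal M$ is a code for a triple of indices of partial computable functions that compute, respectively, the signature, the characteristic function of the universe, and the basic functions and relations. The degree $\mathbf d$ is *loquaciously high for isomorphism* if there is a total $\mathbf d$-computable function $F:\omega\times\omega\to\omega^\omega$ such that, whenever $i$ and $j$ are indices of computable structures $\mathcal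 M_i$ and $\mathcal M_j$ in the same language with $\mathcal M_i\cong\mathcal M_j$, the restriction of $F(i,j)$ to the universe of $\mathcal M_i$ is an isomorphism from $\mathcal M_i$ onto $\mathcal M_j$. Then $\mathbf d$ is loquaciously high for paths if and only if $\mathbf d$ is loquaciously high for isomorphism. -/

import Mathlib

noncomputable section

open scoped FirstOrder

namespace LoquaciousHighness

open Classical in
/-- The characteristic function of a set of natural numbers, as an oracle. -/
def charFun (D : Set ℕ) : ℕ →. ℕ := fun n => Part.some (if n ∈ D then 1 else 0)

/-- Turing equivalence of sets of natural numbers. -/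
def turingSetoid : Setoid (Set ℕ) where
  r D E := TuringEquivalent (charFun D) (charFun E)
  iseqv := TuringEquivalent.equivalence.comap charFun

/-- A Turing degree: an equivalence class of sets of natural numbers under Turing equivalence.
(Mathlib's `TuringDegree` consists of classes of *partial* functions, which is larger.) -/
abbrev Degree : Type := Quotient turingSetoid

/-- The Turing degree of a set. -/
def degreeOf (D : Set ℕ) : Degree := Quotient.mk turingSetoid D

/-- The standard listing `φ₀, φ₁, …` of the partial computable functions. -/
def phi (e : ℕ) : ℕ →. ℕ := (Denumerable.ofNat Nat.Partrec.Code e).eval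

/-- `φ_e` is (total and) the characteristic function of `A`, where the elements of the ambient
type are coded by natural numbers. -/
def Decides {α : Type} [Primcodable α] (e : ℕ) (A : Set α) : Prop :=
  ∀ a : α, (a ∈ A → phi e (Encodable.encode a) = Part.some 1) ∧
    (a ∉ A → phi e (Encodable.encode a) = Part.some 0)

/-! ### Trees and paths -/

/-- `n` is an index of the computable tree `T ⊆ ω^{<ω}`. -/
def IsTreeIndex (n : ℕ) (T : Descriptive.tree ℕ) : Prop :=
  Decides n (T : Set (List ℕ))

/-- `p` is a path through `T`: all finite initial segments of `p` are in `T`. -/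
def IsPath (T : Descriptive.tree ℕ) (p : ℕ → ℕ) : Prop :=
  ∀ k : ℕ, (List.range k).map p ∈ T

/-- The tree `T` is ill founded: it has a path. -/
def IllFounded (T : Descriptive.tree ℕ) : Prop := ∃ p : ℕ → ℕ, IsPath T p

/-- `d` is loquaciously high for paths: there is a total `d`-computable `F : ω → ω^ω` such that
`F(n)` is a path through the computable tree with index `n` whenever this tree is ill founded. -/
def LoquaciouslyHighForPaths (d : Degree) : Prop :=
  ∃ D : Set ℕ, degreeOf D = d ∧ ∃ F : ℕ → ℕ → ℕ,
    ComputableIn {charFun D} (fun q : ℕ × ℕ => F q.1 q.2) ∧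
    ∀ (n : ℕ) (T : Descriptive.tree ℕ),
      IsTreeIndex n T → IllFounded T → IsPath T (F n)

/-! ### Computable structures -/

/-- A countable signature with symbols named by natural numbers: `s k = none` if `k` is not a
symbol, `s k = some (Sum.inl m)` if `k` is an `m`-ary function symbol (a constant if `m = 0`), and
`s k = some (Sum.inr m)` if `k` is an `m`-ary relation symbol. -/
abbrev Signature : Type := ℕ → Option (ℕ ⊕ ℕ)

/-- The first-order language with the given signature. -/
def Signature.lang (s : Signature) : FirstOrder.Language.{0, 0} where
  Functions m := {k : ℕ // s k = some (Sum.inl m)}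
  Relations m := {k : ℕ // s k = some (Sum.inr m)}

/-- `i` codes a triple `(a, b, c)` witnessing that the given structure in the language with
signature `s`, whose universe is `A ⊆ ω`, is computable: `φ_a` computes the signature, `φ_b` is
the characteristic function of the universe, and `φ_c` computes, uniformly in the symbol, the
values of the basic functions and the truth values of the basic relations. -/
def IsStructureIndex (i : ℕ) (s : Signature) (A : Set ℕ) [s.lang.Structure A] : Prop :=
  ∃ a b c : ℕ, i = Nat.pair a (Nat.pair b c) ∧
    (∀ k : ℕ, phi a k = Part.some (Encodable.encode (s k))) ∧
    Decides b A ∧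
    (∀ (m : ℕ) (f : s.lang.Functions m) (x : Fin m → A),
      phi c (Encodable.encode (f.1, List.ofFn fun t => (x t : ℕ))) =
        Part.some (FirstOrder.Language.Structure.funMap f x : A).1) ∧
    (∀ (m : ℕ) (r : s.lang.Relations m) (x : Fin m → A),
      (FirstOrder.Language.Structure.RelMap r x →
        phi c (Encodable.encode (r.1, List.ofFn fun t => (x t : ℕ))) = Part.some 1) ∧
      (¬ FirstOrder.Language.Structure.RelMap r x →
        phi c (Encodable.encode (r.1, List.ofFn fun t => (x t : ℕ))) = Part.some 0))

/-- `d` is loquaciously high for isomorphism: there is a total `d`-computable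
`F : ω × ω → ω^ω` such that, whenever `i` and `j` are indices of isomorphic computable structures
(in the same, arbitrary computable language), `F(i, j)` restricts to an isomorphism from the
structure with index `i` onto the one with index `j`. -/
def LoquaciouslyHighForIsomorphism (d : Degree) : Prop :=
  ∃ D : Set ℕ, degreeOf D = d ∧ ∃ F : ℕ → ℕ → ℕ → ℕ,
    ComputableIn {charFun D} (fun q : ℕ × ℕ × ℕ => F q.1 q.2.1 q.2.2) ∧
    ∀ (i j : ℕ) (s : Signature) (A B : Set ℕ) [s.lang.Structure A] [s.lang.Structure B],
      IsStructureIndex i s A → IsStructureIndex j s B → Nonempty (A ≃[s.lang] B) →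
        ∃ g : A ≃[s.lang] B, ∀ x : A, (g x : ℕ) = F i j (x : ℕ)

end LoquaciousHighness

end

/-!
Both properties say that the oracle uniformly finds, for primitive recursive conditions `R`, a
function all of whose initial segments satisfy `R`, if there is one.

Isomorphisms reduce to branches because being an isomorphism between two computable structures is a
conjunction of conditions that are decidable in the limit from the candidate and its inverse: a
branch carries, next to the values of the candidate, guesses from which stage on each condition has
settled.

For the converse, let `S` be the set of nodes and consider the finite sums of nodes of length `k`,
with coefficients in the field with two elements, for `k = 0, 1, …`, related by restriction to the
previous level. Mark the empty sum at level zero in one copy, and the sum consisting of the root in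
another. If `S` has a branch, then adding its initial segments is an isomorphism between the two
copies. Conversely, any isomorphism maps the empty sums to a coherent sequence of sums that starts
with the root. A node of odd multiplicity in one sum of this sequence extends to one in the next, so
following odd multiplicities from the root leads along a branch of `S`.
-/

namespace LoquaciousHighness

open Denumerable Encodable Filter Nat.Partrec

/-! ### Oracle computability and primitive recursion -/

section Computability

variable {α β γ σ : Type*} [Primcodable α] [Primcodable β] [Primcodable γ] [Primcodable σ]
variable {O : Set (ℕ →. ℕ)}

theorem computableIn_comp {f : β → σ} {g : α → β} (hf : ComputableIn O f)
    (hg : ComputableIn O g) : ComputableIn O fun a => f (g a) :=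
  (Nat.RecursiveIn.comp hf hg).of_eq fun n => by
    cases decode (α := α) n <;> simp [encodek]

theorem computableIn_pair {f : α → β} {g : α → γ} (hf : ComputableIn O f)
    (hg : ComputableIn O g) : ComputableIn O fun a => (f a, g a) :=
  (Nat.RecursiveIn.pair hf hg).of_eq fun n => by
    cases decode (α := α) n <;> simp [Seq.seq]

theorem computableIn_comp₂ {f : β → γ → σ} {g : α → β} {h : α → γ} (hf : ComputableIn₂ O f)
    (hg : ComputableIn O g) (hh : ComputableIn O h) : ComputableIn O fun a => f (g a) (h a) :=
  computableIn_comp hf (computableIn_pair hg hh)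

theorem computableIn₂_nat_rec {f : α → σ} {h : α → ℕ × σ → σ} (hf : ComputableIn O f)
    (hh : ComputableIn₂ O h) :
    ComputableIn₂ O fun a n => (Nat.rec (f a) (fun k x => h a (k, x)) n : σ) :=
  (Nat.RecursiveIn.prec hf hh).of_eq fun n => by
    rw [decode_prod_val]
    obtain ⟨m, k⟩ := n.unpair
    rcases ha : decode (α := α) m with _ | a
    · induction k with
      | zero => simp [ha]
      | succ k ih => simp_all
    · simp only [ha, Option.bind_some, decode_nat, Option.map_some, Part.coe_some, Part.bind_some,
        Part.map_some]
      induction k with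
      | zero => simp
      | succ k ih => simp only [ih]; simp [ha]

theorem primrecPred_imp {p q : α → Prop} (hp : PrimrecPred p) (hq : PrimrecPred q) :
    PrimrecPred fun a => p a → q a :=
  (hp.not.or hq).of_eq fun _ => imp_iff_not_or.symm

theorem primrecPred_forall_mem {f : α → List β} {p : α → β → Prop} (hf : Primrec f)
    (hp : PrimrecRel p) : PrimrecPred fun a => ∀ b ∈ f a, p a b :=
  hp.swap.forall_mem_list.comp hf .id

theorem primrecPred_forall_lt {f : α → ℕ} {p : α → ℕ → Prop} (hf : Primrec f)
    (hp : PrimrecRel p) : PrimrecPred fun a => ∀ n < f a, p a n :=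
  (primrecPred_forall_mem (Primrec.list_range.comp hf) hp).of_eq fun a => by
    simp only [List.mem_range]

theorem primrec₂_count [BEq α] [LawfulBEq α] : Primrec₂ fun (l : List α) (a : α) => l.count a :=
  (Primrec.list_length.comp (PrimrecRel.listFilter (R := fun b a : α => b == a)
    (Primrec.eq.of_eq fun _ _ => beq_iff_eq.symm))).of_eq fun q => by
      simp [List.count_eq_length_filter]

theorem primrecPred_odd {f : α → ℕ} (hf : Primrec f) : PrimrecPred fun a => Odd (f a) :=
  (Primrec.eq.comp (Primrec.nat_mod.comp hf (.const 2)) (.const 1)).of_eq fun _ =>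
    Nat.odd_iff.symm

end Computability

/-! ### Indices -/

/-- The computation of `φ_e` at `x`, cut off after `n` steps. -/
def phiStage (n e x : ℕ) : Option ℕ := Code.evaln n (ofNat Code e) x

theorem primrec_phiStage : Primrec fun q : ℕ × ℕ × ℕ => phiStage q.1 q.2.1 q.2.2 :=
  Code.primrec_evaln.comp ((Primrec.fst.pair
    ((Primrec.ofNat Code).comp (Primrec.fst.comp .snd))).pair (Primrec.snd.comp .snd))

theorem eventually_phiStage_eq_some_iff (e x y : ℕ) :
    ∀ᶠ n in atTop, (phiStage n e x = some y ↔ phi e x = Part.some y) := by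
  by_cases h : phi e x = Part.some y
  · obtain ⟨k, hk⟩ := Code.evaln_complete.1 (Part.eq_some_iff.1 h)
    filter_upwards [eventually_ge_atTop k] with n hn
    exact iff_of_true (Code.evaln_mono hn hk) h
  · exact .of_forall fun n =>
      iff_of_false (fun hn => h (Part.eq_some_iff.2 (Code.evaln_sound hn))) h

theorem exists_primrec_index {α : Type*} [Primcodable α] {f : α → ℕ → ℕ} (hf : Primrec₂ f) :
    ∃ h : α → ℕ, Primrec h ∧ ∀ a x, phi (h a) x = Part.some (f a x) := by
  have hf' : Primrec₂ fun n x => ((decode (α := α) n).map fun a => f a x).getD 0 :=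
    Primrec.option_getD.comp (Primrec.option_map (Primrec.decode.comp .fst)
      (hf.comp .snd (Primrec.snd.comp .fst))) (.const 0)
  obtain ⟨c, hc⟩ := Code.exists_code.1 (Nat.Partrec.of_primrec (Primrec₂.unpaired'.2 hf'))
  refine ⟨fun a => encode (Code.curry c (encode a)),
    Primrec.encode.comp (Code.primrec₂_curry.comp (.const c) .encode), fun a x => ?_⟩
  simp [phi, Code.eval_curry, hc]

open Classical in
theorem exists_primrec_index_of_primrecRel {α β : Type*} [Primcodable α] [Primcodable β]
    {p : α → β → Prop} (hp : PrimrecRel p) :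
    ∃ h : α → ℕ, Primrec h ∧
      ∀ a b, phi (h a) (encode b) = Part.some (if p a b then 1 else 0) := by
  obtain ⟨h, hh, hphi⟩ := exists_primrec_index
    (f := fun a x => ((decode (α := β) x).map fun b => if p a b then 1 else 0).getD 0)
    (Primrec.option_getD.comp (Primrec.option_map (Primrec.decode.comp .snd)
      (Primrec.ite (hp.comp (Primrec.fst.comp .fst) .snd) (.const 1) (.const 0))) (.const 0))
  exact ⟨h, hh, fun a b => by simp [hphi]⟩

section Decides

variable {α : Type} [Primcodable α] {e : ℕ} {A : Set α}

open Classical in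
theorem decides_iff :
    Decides e A ↔ ∀ a, phi e (encode a) = Part.some (if a ∈ A then 1 else 0) :=
  forall_congr' fun a => by by_cases ha : a ∈ A <;> simp [ha]

theorem Decides.mem_iff (h : Decides e A) {a : α} : a ∈ A ↔ phi e (encode a) = Part.some 1 := by
  classical
  by_cases ha : a ∈ A <;> simp [decides_iff.1 h, ha]

end Decides

/-! ### Conditions decidable in the limit -/

section Limit

variable {α β γ : Type*} [Primcodable α] [Primcodable β] [Primcodable γ]

/-- `f a p` is the eventual value of a primitive recursive function of `a` and the initial
segments of `p`. Sequences and conditions of this kind are what can be checked along the branches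
of a tree once the stage from which the value is correct is guessed as well. -/
def LimitComputable (f : α → (ℕ → ℕ) → β) : Prop :=
  ∃ g : α → List ℕ → β, Primrec₂ g ∧ ∀ a p, ∀ᶠ n in atTop, g a ((List.range n).map p) = f a p

/-- The analogue of `LimitComputable` for predicates. -/
def LimitDecidable (P : α → (ℕ → ℕ) → Prop) : Prop :=
  ∃ R : α → List ℕ → Prop, PrimrecRel R ∧
    ∀ a p, ∀ᶠ n in atTop, (R a ((List.range n).map p) ↔ P a p)

theorem LimitComputable.of_primrec {f : α → β} (hf : Primrec f) :
    LimitComputable fun a _ => f a :=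
  ⟨fun a _ => f a, hf.comp .fst, fun _ _ => .of_forall fun _ => rfl⟩

theorem limitComputable_apply : LimitComputable fun n (p : ℕ → ℕ) => p n :=
  ⟨fun n σ => σ.getD n 0, (Primrec.list_getD 0).comp .snd .fst, fun n p =>
    (eventually_gt_atTop n).mono fun k hk => by simp [hk]⟩

theorem LimitComputable.comp {f : β → (ℕ → ℕ) → γ} {g : α → (ℕ → ℕ) → β}
    (hf : LimitComputable f) (hg : LimitComputable g) : LimitComputable fun a p => f (g a p) p := by
  obtain ⟨f', hf', hlimf⟩ := hf
  obtain ⟨g', hg', hlimg⟩ := hg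
  refine ⟨fun a σ => f' (g' a σ) σ, hf'.comp hg' .snd, fun a p => ?_⟩
  filter_upwards [hlimg a p, hlimf (g a p) p] with n hn hn'
  rw [hn, hn']

theorem LimitComputable.pair {f : α → (ℕ → ℕ) → β} {g : α → (ℕ → ℕ) → γ}
    (hf : LimitComputable f) (hg : LimitComputable g) :
    LimitComputable fun a p => (f a p, g a p) := by
  obtain ⟨f', hf', hlimf⟩ := hf
  obtain ⟨g', hg', hlimg⟩ := hg
  refine ⟨fun a σ => (f' a σ, g' a σ), Primrec.pair hf' hg', fun a p => ?_⟩
  filter_upwards [hlimf a p, hlimg a p] with n hn hn' using Prod.ext hn hn'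

theorem LimitComputable.list_map {l : α → List β} {f : β → (ℕ → ℕ) → γ} (hl : Primrec l)
    (hf : LimitComputable f) : LimitComputable fun a p => (l a).map fun b => f b p := by
  obtain ⟨f', hf', hlim⟩ := hf
  refine ⟨fun a σ => (l a).map fun b => f' b σ, Primrec.list_map (hl.comp .fst)
    (hf'.comp .snd (Primrec.snd.comp .fst)), fun a p => ?_⟩
  filter_upwards [(eventually_all_finite (List.finite_toSet (l a))).2 fun b _ => hlim b p]
    with n hn using List.map_congr_left hn

theorem LimitDecidable.eq {f g : α → (ℕ → ℕ) → β} (hf : LimitComputable f)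
    (hg : LimitComputable g) : LimitDecidable fun a p => f a p = g a p := by
  obtain ⟨f', hf', hlimf⟩ := hf
  obtain ⟨g', hg', hlimg⟩ := hg
  refine ⟨fun a σ => f' a σ = g' a σ, Primrec.eq.comp hf' hg', fun a p => ?_⟩
  filter_upwards [hlimf a p, hlimg a p] with n hn hn'
  rw [hn, hn']

theorem LimitDecidable.phi_eq_some {e x y : α → (ℕ → ℕ) → ℕ} (he : LimitComputable e)
    (hx : LimitComputable x) (hy : LimitComputable y) :
    LimitDecidable fun a p => phi (e a p) (x a p) = Part.some (y a p) := by
  obtain ⟨f, hf, hlim⟩ := he.pair (hx.pair hy)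
  refine ⟨fun a σ => phiStage σ.length (f a σ).1 (f a σ).2.1 = some (f a σ).2.2, ?_, fun a p => ?_⟩
  · exact Primrec.eq.comp (primrec_phiStage.comp ((Primrec.list_length.comp .snd).pair
      ((Primrec.fst.comp hf).pair (Primrec.fst.comp (Primrec.snd.comp hf)))))
      (Primrec.option_some.comp (Primrec.snd.comp (Primrec.snd.comp hf)))
  · filter_upwards [hlim a p, eventually_phiStage_eq_some_iff (e a p) (x a p) (y a p)]
      with n hn hphi
    simpa [hn] using hphi

theorem LimitDecidable.and {P Q : α → (ℕ → ℕ) → Prop} (hP : LimitDecidable P)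
    (hQ : LimitDecidable Q) : LimitDecidable fun a p => P a p ∧ Q a p := by
  obtain ⟨R, hR, hlim⟩ := hP
  obtain ⟨R', hR', hlim'⟩ := hQ
  refine ⟨fun a σ => R a σ ∧ R' a σ, PrimrecPred.and hR hR', fun a p => ?_⟩
  filter_upwards [hlim a p, hlim' a p] with n hn hn' using and_congr hn hn'

theorem LimitDecidable.imp {P Q : α → (ℕ → ℕ) → Prop} (hP : LimitDecidable P)
    (hQ : LimitDecidable Q) : LimitDecidable fun a p => P a p → Q a p := by
  obtain ⟨R, hR, hlim⟩ := hP
  obtain ⟨R', hR', hlim'⟩ := hQ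
  refine ⟨fun a σ => R a σ → R' a σ, primrecPred_imp hR hR', fun a p => ?_⟩
  filter_upwards [hlim a p, hlim' a p] with n hn hn' using imp_congr hn hn'

theorem LimitDecidable.forall_mem {l : α → List β} {P : α × β → (ℕ → ℕ) → Prop} (hl : Primrec l)
    (hP : LimitDecidable P) : LimitDecidable fun a p => ∀ b ∈ l a, P (a, b) p := by
  obtain ⟨R, hR, hlim⟩ := hP
  refine ⟨fun a σ => ∀ b ∈ l a, R (a, b) σ, primrecPred_forall_mem (hl.comp .fst)
    (hR.comp (Primrec.pair (Primrec.fst.comp .fst) .snd) (Primrec.snd.comp .fst)), fun a p => ?_⟩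
  filter_upwards [(eventually_all_finite (List.finite_toSet (l a))).2 fun b _ => hlim (a, b) p]
    with n hn using forall₂_congr hn

end Limit

/-! ### Paths and branches -/

section Branches

variable {O : Set (ℕ →. ℕ)}

/-- The property of an oracle `O` behind `LoquaciouslyHighForPaths`: from an index of an
ill-founded computable tree, `O` computes a path through it. -/
def ComputesPaths (O : Set (ℕ →. ℕ)) : Prop :=
  ∃ F : ℕ → ℕ → ℕ, ComputableIn O (fun q : ℕ × ℕ => F q.1 q.2) ∧
    ∀ (n : ℕ) (T : Descriptive.tree ℕ), IsTreeIndex n T → IllFounded T → IsPath T (F n)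

/-- From the parameter of a uniformly primitive recursive family of sets of finite sequences, `O`
computes a function all of whose initial segments lie in the corresponding set, if there is one.
The sets need not be closed under initial segments. -/
def ComputesBranches (O : Set (ℕ →. ℕ)) : Prop :=
  ∀ ⦃α : Type⦄ [Primcodable α] (R : α → List ℕ → Prop), PrimrecRel R →
    ∃ G : α → ℕ → ℕ, ComputableIn₂ O G ∧
      ∀ a, (∃ g : ℕ → ℕ, ∀ k, R a ((List.range k).map g)) → ∀ k, R a ((List.range k).map (G a))

theorem take_map_range (p : ℕ → ℕ) {m k : ℕ} (h : m ≤ k) :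
    ((List.range k).map p).take m = (List.range m).map p := by
  rw [← List.map_take, List.take_range, min_eq_left h]

/-- The tree of the sequences all of whose initial segments lie in `S`. -/
def prefixTree (S : Set (List ℕ)) : Descriptive.tree ℕ :=
  ⟨{σ | ∀ τ, τ <+: σ → τ ∈ S}, fun σ a h τ hτ => h τ (hτ.trans (List.prefix_append σ [a]))⟩

theorem isPath_prefixTree {S : Set (List ℕ)} {p : ℕ → ℕ} :
    IsPath (prefixTree S) p ↔ ∀ k, (List.range k).map p ∈ S := by
  refine ⟨fun h k => h k _ List.prefix_rfl, fun h k τ hτ => ?_⟩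
  have hlen : τ.length ≤ k := by simpa using hτ.length_le
  rw [List.prefix_iff_eq_take.1 hτ, take_map_range p hlen]
  exact h τ.length

theorem primrecRel_mem_prefixTree {α : Type*} [Primcodable α] {R : α → List ℕ → Prop}
    (hR : PrimrecRel R) : PrimrecRel fun a σ => σ ∈ prefixTree {τ | R a τ} := by
  have htake : PrimrecRel fun a (σ : List ℕ) => ∀ m < σ.length + 1, R a (σ.take m) :=
    primrecPred_forall_lt (Primrec.succ.comp (Primrec.list_length.comp .snd))
      (hR.comp (Primrec.fst.comp .fst) (Primrec.list_take.comp .snd (Primrec.snd.comp .fst)))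
  refine htake.of_eq fun a σ => ⟨fun h τ hτ => ?_, fun h m _ => h _ (List.take_prefix m σ)⟩
  rw [List.prefix_iff_eq_take.1 hτ]
  exact h _ (Nat.lt_succ_of_le hτ.length_le)

theorem ComputesPaths.computesBranches (hO : ComputesPaths O) : ComputesBranches O := by
  obtain ⟨F, hF, hpath⟩ := hO
  intro α _ R hR
  obtain ⟨i, hi, hdec⟩ := exists_primrec_index_of_primrecRel (primrecRel_mem_prefixTree hR)
  refine ⟨fun a => F (i a), computableIn_comp hF
    (computableIn_pair (hi.comp .fst).computableIn Primrec.snd.computableIn), fun a ⟨g, hg⟩ => ?_⟩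
  exact isPath_prefixTree.1 (hpath (i a) _ (decides_iff.2 (hdec a)) ⟨g, isPath_prefixTree.2 hg⟩)

variable {α γ : Type} [Primcodable α] [Denumerable γ]

theorem ComputesBranches.exists_solution (hO : ComputesBranches O)
    {P : α × γ → (ℕ → ℕ) → Prop} (hP : LimitDecidable P) :
    ∃ G : α → ℕ → ℕ, ComputableIn₂ O G ∧
      ∀ a, (∃ p, ∀ c, P (a, c) p) → ∀ c, P (a, c) (G a) := by
  obtain ⟨R, hR, hlim⟩ := hP
  have hvalues : Primrec fun σ : List ℕ => σ.map fun x => x.unpair.1 :=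
    Primrec.list_map .id (Primrec.fst.comp (Primrec.unpair.comp .snd)).to₂
  have hstage : Primrec₂ fun (σ : List ℕ) m => (σ.getD m 0).unpair.2 :=
    Primrec.snd.comp (Primrec.unpair.comp (Primrec.list_getD 0))
  -- Along a branch, the entry `Nat.pair y s` in position `m` claims that the solution has value
  -- `y` at `m`, and that `R` is correct for the `m`-th condition from length `s` on.
  obtain ⟨G, hG, hbranch⟩ := hO
    (fun a σ => ∀ m < σ.length, (σ.getD m 0).unpair.2 ≤ σ.length →
      R (a, ofNat γ m) (σ.map fun x => x.unpair.1))
    (primrecPred_forall_lt (Primrec.list_length.comp .snd)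
      (primrecPred_imp
        (Primrec.nat_le.comp (hstage.comp (Primrec.snd.comp .fst) .snd)
          (Primrec.list_length.comp (Primrec.snd.comp .fst)))
        (hR.comp (Primrec.pair (Primrec.fst.comp .fst) ((Primrec.ofNat γ).comp .snd))
          (hvalues.comp (Primrec.snd.comp .fst)))))
  refine ⟨fun a x => (G a x).unpair.1, computableIn_comp (f := fun x : ℕ => x.unpair.1)
    (Primrec.fst.comp Primrec.unpair).computableIn hG, fun a ⟨p, hp⟩ c => ?_⟩
  have hG' := hbranch a ?_
  · obtain ⟨n, hn, hc, hs⟩ := ((hlim (a, c) _).and ((eventually_gt_atTop (encode c)).and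
      (eventually_ge_atTop (G a (encode c)).unpair.2))).exists
    refine hn.1 ?_
    simpa [hc, hs, Function.comp_def] using hG' n (encode c)
  · choose s hs using fun m => eventually_atTop.1 (hlim (a, ofNat γ m) p)
    refine ⟨fun m => Nat.pair (p m) (s m), fun k m hm hle => ?_⟩
    rw [List.length_map, List.length_range] at hm hle
    simpa [Function.comp_def] using (hs m k (by simpa [hm] using hle)).2 (hp (ofNat γ m))

theorem ComputesBranches.computesPaths (hO : ComputesBranches O) : ComputesPaths O := by
  obtain ⟨G, hG, hsol⟩ := hO.exists_solution
    (P := fun (n, k) p => phi n (encode ((List.range k).map p)) = Part.some 1)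
    (.phi_eq_some (.of_primrec .fst)
      (.comp (.of_primrec .encode) (.list_map (Primrec.list_range.comp .snd) limitComputable_apply))
      (.of_primrec (.const 1)))
  exact ⟨G, hG, fun n T hT ⟨p, hp⟩ k => hT.mem_iff.2 (hsol n ⟨p, fun k => hT.mem_iff.1 (hp k)⟩ k)⟩

end Branches

/-! ### From branches to isomorphisms -/

open scoped FirstOrder

/-- The property of an oracle `O` behind `LoquaciouslyHighForIsomorphism`: from indices of two
isomorphic computable structures, `O` computes an isomorphism between them. -/
def ComputesIsomorphisms (O : Set (ℕ →. ℕ)) : Prop :=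
  ∃ F : ℕ → ℕ → ℕ → ℕ, ComputableIn O (fun q : ℕ × ℕ × ℕ => F q.1 q.2.1 q.2.2) ∧
    ∀ (i j : ℕ) (s : Signature) (A B : Set ℕ) [s.lang.Structure A] [s.lang.Structure B],
      IsStructureIndex i s A → IsStructureIndex j s B → Nonempty (A ≃[s.lang] B) →
        ∃ g : A ≃[s.lang] B, ∀ x : A, (g x : ℕ) = F i j (x : ℕ)

/-- The component of the triple coded by `i` that computes the signature. -/
def signatureIndex (i : ℕ) : ℕ := i.unpair.1

/-- The component of the triple coded by `i` that decides the universe. -/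
def universeIndex (i : ℕ) : ℕ := i.unpair.2.unpair.1

/-- The component of the triple coded by `i` that computes the basic functions and relations. -/
def symbolIndex (i : ℕ) : ℕ := i.unpair.2.unpair.2

theorem primrec_signatureIndex : Primrec signatureIndex :=
  Primrec.fst.comp .unpair

theorem primrec_universeIndex : Primrec universeIndex :=
  Primrec.fst.comp (Primrec.unpair.comp (Primrec.snd.comp .unpair))

theorem primrec_symbolIndex : Primrec symbolIndex :=
  Primrec.snd.comp (Primrec.unpair.comp (Primrec.snd.comp .unpair))

section IsStructureIndex

open FirstOrder.Language.Structure

variable {i : ℕ} {s : Signature} {A : Set ℕ} [s.lang.Structure A]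

open Classical in
theorem isStructureIndex_iff :
    IsStructureIndex i s A ↔
      (∀ k, phi (signatureIndex i) k = Part.some (encode (s k))) ∧
      Decides (universeIndex i) A ∧
      (∀ (m : ℕ) (f : s.lang.Functions m) (x : Fin m → A),
        phi (symbolIndex i) (encode (f.1, List.ofFn fun t => (x t : ℕ))) =
          Part.some (funMap f x : A).1) ∧
      (∀ (m : ℕ) (r : s.lang.Relations m) (x : Fin m → A),
        phi (symbolIndex i) (encode (r.1, List.ofFn fun t => (x t : ℕ))) =
          Part.some (if RelMap r x then 1 else 0)) := by
  have hrel (m : ℕ) (r : s.lang.Relations m) (x : Fin m → A) (c : ℕ) :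
      ((RelMap r x → phi c (encode (r.1, List.ofFn fun t => (x t : ℕ))) = Part.some 1) ∧
        (¬ RelMap r x → phi c (encode (r.1, List.ofFn fun t => (x t : ℕ))) = Part.some 0)) ↔
      phi c (encode (r.1, List.ofFn fun t => (x t : ℕ))) =
        Part.some (if RelMap r x then 1 else 0) := by
    by_cases hr : RelMap r x <;> simp [hr]
  simp only [IsStructureIndex, hrel]
  constructor
  · rintro ⟨a, b, c, rfl, h⟩
    simpa [signatureIndex, universeIndex, symbolIndex] using h
  · exact fun h => ⟨signatureIndex i, universeIndex i, symbolIndex i,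
      by simp [signatureIndex, universeIndex, symbolIndex], h⟩

end IsStructureIndex

/-- The condition at `x` for `u` to map the set decided by `φ_b` into the set decided by `φ_b'`,
with left inverse `v`. -/
def MapsWithLeftInverse (b b' : ℕ) (u v : ℕ → ℕ) (x : ℕ) : Prop :=
  phi b x = Part.some 1 → phi b' (u x) = Part.some 1 ∧ v (u x) = x

/-- The condition for `u` to preserve the symbol `k` from the structure with index `i` to the
structure with index `j`, at the list of arguments `l` and the value `y`. -/
def PreservesSymbol (i j : ℕ) (u : ℕ → ℕ) (k : ℕ) (l : List ℕ) (y : ℕ) : Prop :=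
  (∀ x ∈ l, phi (universeIndex i) x = Part.some 1) →
    phi (symbolIndex i) (encode (k, l)) = Part.some y →
      (phi (signatureIndex i) k = Part.some (encode (some (Sum.inl l.length : ℕ ⊕ ℕ))) →
        phi (symbolIndex j) (encode (k, l.map u)) = Part.some (u y)) ∧
      (phi (signatureIndex i) k = Part.some (encode (some (Sum.inr l.length : ℕ ⊕ ℕ))) →
        phi (symbolIndex j) (encode (k, l.map u)) = Part.some y)

/-- The conditions indexed by `n`, `l` and `y` that together express that `u` and `v` are mutually
inverse isomorphisms between the structures with indices `i` and `j`. The number `n` stands both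
for an element and for a symbol. -/
def IsoCondition (i j : ℕ) (u v : ℕ → ℕ) (n : ℕ) (l : List ℕ) (y : ℕ) : Prop :=
  MapsWithLeftInverse (universeIndex i) (universeIndex j) u v n ∧
  MapsWithLeftInverse (universeIndex j) (universeIndex i) v u n ∧
  PreservesSymbol i j u n l y

section LimitDecidable

variable {α : Type*} [Primcodable α] {u v : (ℕ → ℕ) → ℕ → ℕ} {i j k x y : α → ℕ} {l : α → List ℕ}

theorem limitDecidable_mapsWithLeftInverse (hu : LimitComputable fun x p => u p x)
    (hv : LimitComputable fun x p => v p x) (hi : Primrec i) (hj : Primrec j) (hx : Primrec x) :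
    LimitDecidable fun a p => MapsWithLeftInverse (i a) (j a) (u p) (v p) (x a) :=
  have hux := hu.comp (.of_primrec hx)
  .imp (.phi_eq_some (.of_primrec hi) (.of_primrec hx) (.of_primrec (.const 1)))
    (.and (.phi_eq_some (.of_primrec hj) hux (.of_primrec (.const 1)))
      (.eq (hv.comp hux) (.of_primrec hx)))

theorem limitDecidable_preservesSymbol (hu : LimitComputable fun x p => u p x) (hi : Primrec i)
    (hj : Primrec j) (hk : Primrec k) (hl : Primrec l) (hy : Primrec y) :
    LimitDecidable fun a p => PreservesSymbol (i a) (j a) (u p) (k a) (l a) (y a) := by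
  have hlen : Primrec fun a => (l a).length := Primrec.list_length.comp hl
  have hsig {t : α → ℕ ⊕ ℕ} (ht : Primrec t) : LimitDecidable fun a (_ : ℕ → ℕ) =>
      phi (signatureIndex (i a)) (k a) = Part.some (encode (some (t a))) :=
    .phi_eq_some (.of_primrec (primrec_signatureIndex.comp hi)) (.of_primrec hk)
      (.of_primrec (Primrec.encode.comp (Primrec.option_some.comp ht)))
  have himage {z : α → (ℕ → ℕ) → ℕ} (hz : LimitComputable z) : LimitDecidable fun a p =>
      phi (symbolIndex (j a)) (encode (k a, (l a).map (u p))) = Part.some (z a p) :=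
    .phi_eq_some (.of_primrec (primrec_symbolIndex.comp hj))
      (.comp (.of_primrec .encode) (.pair (.of_primrec hk) (.list_map hl hu))) hz
  refine .imp (.forall_mem hl (P := fun (a, x) _ => phi (universeIndex (i a)) x = Part.some 1)
    (.phi_eq_some (.of_primrec (primrec_universeIndex.comp (hi.comp .fst))) (.of_primrec .snd)
      (.of_primrec (.const 1)))) (.imp ?_ (.and (.imp ?_ ?_) (.imp ?_ ?_)))
  · exact .phi_eq_some (.of_primrec (primrec_symbolIndex.comp hi))
      (.of_primrec (Primrec.encode.comp (hk.pair hl))) (.of_primrec hy)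
  · exact hsig (Primrec.sumInl.comp hlen)
  · exact himage (hu.comp (.of_primrec hy))
  · exact hsig (Primrec.sumInr.comp hlen)
  · exact himage (.of_primrec hy)

theorem limitDecidable_isoCondition (hu : LimitComputable fun x p => u p x)
    (hv : LimitComputable fun x p => v p x) (hi : Primrec i) (hj : Primrec j) (hx : Primrec x)
    (hl : Primrec l) (hy : Primrec y) :
    LimitDecidable fun a p => IsoCondition (i a) (j a) (u p) (v p) (x a) (l a) (y a) :=
  have hi' := primrec_universeIndex.comp hi
  have hj' := primrec_universeIndex.comp hj
  .and (limitDecidable_mapsWithLeftInverse hu hv hi' hj' hx)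
    (.and (limitDecidable_mapsWithLeftInverse hv hu hj' hi' hx)
      (limitDecidable_preservesSymbol hu hi hj hx hl hy))

end LimitDecidable

section

open FirstOrder.Language.Structure

variable {i j : ℕ} {s : Signature} {A B : Set ℕ} [s.lang.Structure A] [s.lang.Structure B]
variable {u v : ℕ → ℕ}

theorem exists_equiv_of_isoCondition (hi : IsStructureIndex i s A) (hj : IsStructureIndex j s B)
    (h : ∀ n l y, IsoCondition i j u v n l y) : ∃ g : A ≃[s.lang] B, ∀ x : A, (g x : ℕ) = u x := by
  classical
  obtain ⟨hsig, hA, hfun, hrel⟩ := isStructureIndex_iff.1 hi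
  obtain ⟨-, hB, hfun', hrel'⟩ := isStructureIndex_iff.1 hj
  have hu (x : A) := (h x [] 0).1 (hA.mem_iff.1 x.2)
  have hv (y : B) := (h y [] 0).2.1 (hB.mem_iff.1 y.2)
  let e : A ≃ B :=
    { toFun x := ⟨u x, hB.mem_iff.2 (hu x).1⟩
      invFun y := ⟨v y, hA.mem_iff.2 (hv y).1⟩
      left_inv x := Subtype.ext (hu x).2
      right_inv y := Subtype.ext (hv y).2 }
  have hsymb {m : ℕ} (k y : ℕ) (x : Fin m → A) :=
    (h k (List.ofFn fun t => (x t : ℕ)) y).2.2 (List.forall_mem_ofFn_iff.2 fun t =>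
      hA.mem_iff.1 (x t).2)
  simp only [hsig, List.length_ofFn, List.map_ofFn] at hsymb
  refine ⟨⟨e, fun {m} f x => Subtype.ext ?_, fun {m} r x => ?_⟩, fun x => rfl⟩
  · have himage := (hsymb f.1 _ x (hfun m f x)).1 (by rw [f.2])
    exact Part.some_inj.1 (himage.symm.trans (hfun' m f (e ∘ x)))
  · have himage := (hsymb r.1 _ x (hrel m r x)).2 (by rw [r.2])
    have heq := Part.some_inj.1 ((hrel' m r (e ∘ x)).symm.trans himage)
    change RelMap r (e ∘ x) ↔ RelMap r x
    by_cases hr : RelMap r x <;> simpa [hr] using heq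

theorem preservesSymbol_of_equiv (hi : IsStructureIndex i s A) (hj : IsStructureIndex j s B)
    (g : A ≃[s.lang] B) (hu : ∀ x : A, u x = g x) (k : ℕ) (l : List ℕ) (y : ℕ) :
    PreservesSymbol i j u k l y := by
  classical
  obtain ⟨hsig, hA, hfun, hrel⟩ := isStructureIndex_iff.1 hi
  obtain ⟨-, -, hfun', hrel'⟩ := isStructureIndex_iff.1 hj
  intro hl hy
  obtain ⟨m, x, rfl⟩ : ∃ (m : ℕ) (x : Fin m → A), l = List.ofFn fun t => (x t : ℕ) :=
    ⟨l.length, fun t => ⟨l[t], hA.mem_iff.2 (hl _ (List.getElem_mem _))⟩, by simp⟩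
  have hmap : (List.ofFn fun t => (x t : ℕ)).map u = List.ofFn fun t => ((g ∘ x) t : ℕ) := by
    simp [List.map_ofFn, Function.comp_def, hu]
  rw [hmap, List.length_ofFn, hsig]
  refine ⟨fun hk => ?_, fun hk => ?_⟩
  · let f : s.lang.Functions m := ⟨k, encode_injective (Part.some_inj.1 hk)⟩
    obtain rfl := Part.some_inj.1 ((hfun m f x).symm.trans hy)
    rw [hu, g.map_fun]
    exact hfun' m f (g ∘ x)
  · let r : s.lang.Relations m := ⟨k, encode_injective (Part.some_inj.1 hk)⟩
    rw [← hy]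
    refine (hrel' m r (g ∘ x)).trans (Eq.trans ?_ (hrel m r x).symm)
    simp only [g.map_rel]

theorem exists_isoCondition (hi : IsStructureIndex i s A) (hj : IsStructureIndex j s B)
    (g : A ≃[s.lang] B) : ∃ u v : ℕ → ℕ, ∀ n l y, IsoCondition i j u v n l y := by
  classical
  obtain ⟨-, hA, -⟩ := isStructureIndex_iff.1 hi
  obtain ⟨-, hB, -⟩ := isStructureIndex_iff.1 hj
  let u : ℕ → ℕ := fun x => if hx : x ∈ A then g ⟨x, hx⟩ else 0
  let v : ℕ → ℕ := fun y => if hy : y ∈ B then g.symm ⟨y, hy⟩ else 0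
  have hu (x : A) : u x = g x := dif_pos x.2
  have hv (y : B) : v y = g.symm y := dif_pos y.2
  refine ⟨u, v, fun n l y => ⟨fun hn => ?_, fun hn => ?_,
    preservesSymbol_of_equiv hi hj g hu n l y⟩⟩
  · rw [hu ⟨n, hA.mem_iff.2 hn⟩, hv, g.symm_apply_apply]
    exact ⟨hB.mem_iff.1 (g _).2, rfl⟩
  · rw [hv ⟨n, hB.mem_iff.2 hn⟩, hu, g.apply_symm_apply]
    exact ⟨hA.mem_iff.1 (g.symm _).2, rfl⟩

end

theorem ComputesBranches.computesIsomorphisms {O : Set (ℕ →. ℕ)} (hO : ComputesBranches O) :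
    ComputesIsomorphisms O := by
  have hfst : LimitComputable fun x p => (p x).unpair.1 :=
    .comp (.of_primrec (Primrec.fst.comp .unpair)) limitComputable_apply
  have hsnd : LimitComputable fun x p => (p x).unpair.2 :=
    .comp (.of_primrec (Primrec.snd.comp .unpair)) limitComputable_apply
  obtain ⟨G, hG, hsol⟩ := hO.exists_solution (α := ℕ × ℕ) (γ := ℕ × List ℕ × ℕ)
    (P := fun ((i, j), n, l, y) p =>
      IsoCondition i j (fun x => (p x).unpair.1) (fun x => (p x).unpair.2) n l y)
    (limitDecidable_isoCondition hfst hsnd (Primrec.fst.comp .fst) (Primrec.snd.comp .fst)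
      (Primrec.fst.comp .snd) (Primrec.fst.comp (Primrec.snd.comp .snd))
      (Primrec.snd.comp (Primrec.snd.comp .snd)))
  refine ⟨fun i j x => (G (i, j) x).unpair.1, computableIn_comp (f := fun x : ℕ => x.unpair.1)
    (Primrec.fst.comp .unpair).computableIn
    (computableIn_comp₂ hG (Primrec.pair .fst (Primrec.fst.comp .snd)).computableIn
      (Primrec.snd.comp .snd).computableIn), fun i j s A B _ _ hi hj ⟨g⟩ => ?_⟩
  obtain ⟨u, v, huv⟩ := exists_isoCondition hi hj g
  have hcond := hsol (i, j) ⟨fun x => Nat.pair (u x) (v x), fun ⟨n, l, y⟩ => by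
    simpa using huv n l y⟩
  exact exists_equiv_of_isoCondition hi hj fun n l y => hcond (n, l, y)

/-! ### Binary relations as structures -/

/-- The signature all of whose symbols are binary relation symbols. -/
def binarySignature : Signature := fun _ => some (Sum.inr 2)

instance (n : ℕ) : IsEmpty (binarySignature.lang.Functions n) :=
  ⟨fun f => by simpa [binarySignature] using f.2⟩

/-- The structure on `A` in which every symbol denotes the relation `Q`. The arguments are read off
the list of their values, because this is how an index of the structure receives them. -/
abbrev binaryStructure (A : Set ℕ) (Q : ℕ → ℕ → Prop) : binarySignature.lang.Structure A where
  funMap f := isEmptyElim f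
  RelMap _ x :=
    Q ((List.ofFn fun t => (x t : ℕ)).getD 0 0) ((List.ofFn fun t => (x t : ℕ)).getD 1 0)

/-- Isomorphisms of the structures `binaryStructure A Q` and `binaryStructure B Q'` are the
relation isomorphisms between the restrictions of `Q` to `A` and of `Q'` to `B`. -/
def binaryStructureEquiv (A B : Set ℕ) (Q Q' : ℕ → ℕ → Prop) :
    (Subrel Q (· ∈ A) ≃r Subrel Q' (· ∈ B)) ≃
      @FirstOrder.Language.Equiv binarySignature.lang A B (binaryStructure A Q)
        (binaryStructure B Q') :=
  letI := binaryStructure A Q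
  letI := binaryStructure B Q'
  { toFun e :=
      { e.toEquiv with
        map_fun' f := isEmptyElim f
        map_rel' {n} r x := by
          obtain rfl : 2 = n := Sum.inr_injective (Option.some_injective _ r.2)
          exact e.map_rel_iff (a := x 0) (b := x 1) }
    invFun g := ⟨g.toEquiv, fun {x y} => g.map_rel' (n := 2) ⟨0, rfl⟩ ![x, y]⟩ }

theorem exists_primrec_index_binaryStructure {α : Type*} [Primcodable α] {U : α → ℕ → Prop}
    {Q : α → ℕ → ℕ → Prop} (hU : PrimrecRel U)
    (hQ : PrimrecPred fun q : α × ℕ × ℕ => Q q.1 q.2.1 q.2.2) :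
    ∃ h : α → ℕ, Primrec h ∧
      ∀ a, @IsStructureIndex (h a) binarySignature {z | U a z} (binaryStructure _ (Q a)) := by
  classical
  obtain ⟨c, hc, hsig⟩ := exists_primrec_index (α := α)
    (f := fun _ _ => encode (some (Sum.inr 2 : ℕ ⊕ ℕ))) (Primrec.const _)
  obtain ⟨b, hb, hdec⟩ := exists_primrec_index_of_primrecRel hU
  obtain ⟨r, hr, hrel⟩ := exists_primrec_index_of_primrecRel
    (p := fun a (q : ℕ × List ℕ) => Q a (q.2.getD 0 0) (q.2.getD 1 0))
    (hQ.comp (Primrec.fst.pair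
      (((Primrec.list_getD 0).comp (Primrec.snd.comp .snd) (.const 0)).pair
        ((Primrec.list_getD 0).comp (Primrec.snd.comp .snd) (.const 1)))))
  refine ⟨fun a => Nat.pair (c a) (Nat.pair (b a) (r a)),
    Primrec₂.natPair.comp hc (Primrec₂.natPair.comp hb hr), fun a => ?_⟩
  let := binaryStructure {z | U a z} (Q a)
  simp only [isStructureIndex_iff, signatureIndex, universeIndex, symbolIndex, Nat.unpair_pair]
  exact ⟨hsig a, decides_iff.2 (hdec a), fun _ f => isEmptyElim f,
    fun _ s x => hrel a (s.1, List.ofFn fun t => (x t : ℕ))⟩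

/-- The relation isomorphism that replaces the elements of a denumerable type by their codes. -/
def encodeRelIso {β : Type*} [Denumerable β] (U : β → Prop) (Q : β → β → Prop) :
    Subrel Q U ≃r
      Subrel (fun m n => Q (ofNat β m) (ofNat β n)) (· ∈ {n : ℕ | U (ofNat β n)}) where
  toEquiv := (Denumerable.eqv β).subtypeEquiv fun x => by simp [Denumerable.eqv]
  map_rel_iff' := by simp [Denumerable.eqv]

theorem ComputesIsomorphisms.exists_relIso {O : Set (ℕ →. ℕ)} (hO : ComputesIsomorphisms O)
    {α β : Type*} [Primcodable α] [Denumerable β] {U U' : α → β → Prop} {Q Q' : α → β → β → Prop}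
    (hU : PrimrecRel U) (hU' : PrimrecRel U')
    (hQ : PrimrecPred fun q : α × β × β => Q q.1 q.2.1 q.2.2)
    (hQ' : PrimrecPred fun q : α × β × β => Q' q.1 q.2.1 q.2.2) :
    ∃ F : α → β → β, ComputableIn₂ O F ∧
      ∀ a, Nonempty (Subrel (Q a) (U a) ≃r Subrel (Q' a) (U' a)) →
        ∃ e : Subrel (Q a) (U a) ≃r Subrel (Q' a) (U' a), ∀ x, (e x : β) = F a x := by
  have index {V : α → β → Prop} {P : α → β → β → Prop} (hV : PrimrecRel V)
      (hP : PrimrecPred fun q : α × β × β => P q.1 q.2.1 q.2.2) :=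
    exists_primrec_index_binaryStructure (U := fun a n => V a (ofNat β n))
      (Q := fun a m n => P a (ofNat β m) (ofNat β n))
      (hV.comp .fst ((Primrec.ofNat β).comp .snd))
      (hP.comp (Primrec.fst.pair (((Primrec.ofNat β).comp (Primrec.fst.comp .snd)).pair
        ((Primrec.ofNat β).comp (Primrec.snd.comp .snd)))))
  obtain ⟨F, hF, hiso⟩ := hO
  obtain ⟨i, hi, hindex⟩ := index hU hQ
  obtain ⟨j, hj, hindex'⟩ := index hU' hQ'
  refine ⟨fun a x => ofNat β (F (i a) (j a) (encode x)), computableIn_comp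
    (Primrec.ofNat β).computableIn (computableIn_comp hF (Primrec.pair (hi.comp .fst)
      (Primrec.pair (hj.comp .fst) (Primrec.encode.comp .snd))).computableIn), fun a ⟨e⟩ => ?_⟩
  let A := binaryStructure {n | U a (ofNat β n)} fun m n => Q a (ofNat β m) (ofNat β n)
  let B := binaryStructure {n | U' a (ofNat β n)} fun m n => Q' a (ofNat β m) (ofNat β n)
  obtain ⟨g, hg⟩ := @hiso (i a) (j a) binarySignature _ _ A B (hindex a) (hindex' a)
    ⟨binaryStructureEquiv _ _ _ _ (((encodeRelIso _ _).symm.trans e).trans (encodeRelIso _ _))⟩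
  refine ⟨((encodeRelIso _ _).trans ((binaryStructureEquiv _ _ _ _).symm g)).trans
    (encodeRelIso _ _).symm, fun x => ?_⟩
  exact congrArg (ofNat β) (hg (encodeRelIso (U a) (Q a) x))

/-! ### Lists counted modulo two -/

section Parity

variable {α β : Type*} [BEq α] [LawfulBEq α] [BEq β] [LawfulBEq β]

/-- Two lists agree as formal sums with coefficients in the field with two elements. -/
def SameParity (l l' : List α) : Prop := ∀ a, Odd (l.count a) ↔ Odd (l'.count a)

theorem primrecRel_sameParity {α : Type*} [Primcodable α] [BEq α] [LawfulBEq α] :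
    PrimrecRel (SameParity (α := α)) := by
  have hcount : PrimrecRel fun (q : List α × List α) a => Odd (q.1.count a) ↔ Odd (q.2.count a) :=
    have hl := primrecPred_odd (primrec₂_count.comp (Primrec.fst.comp .fst) .snd)
    have hl' := primrecPred_odd (primrec₂_count.comp (Primrec.snd.comp .fst) .snd)
    ((primrecPred_imp hl hl').and (primrecPred_imp hl' hl)).of_eq fun _ =>
      iff_iff_implies_and_implies.symm
  refine (primrecPred_forall_mem Primrec.list_append hcount).of_eq fun q => ⟨fun h a => ?_,
    fun h a _ => h a⟩
  by_cases ha : a ∈ q.1 ++ q.2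
  · exact h a ha
  · simp_all [List.count_eq_zero_of_not_mem]

theorem odd_count_cons {a b : α} {l : List α} :
    Odd ((a :: l).count b) ↔ (Odd (l.count b) ↔ a ≠ b) := by
  by_cases h : a = b <;> simp [h, Nat.odd_add_one]

theorem exists_odd_count_of_odd_count_map {f : α → β} {l : List α} {b : β}
    (h : Odd ((l.map f).count b)) : ∃ a ∈ l, f a = b ∧ Odd (l.count a) := by
  classical
  by_contra! hl
  refine Nat.not_even_iff_odd.2 h (even_iff_two_dvd.2 ?_)
  rw [List.count, List.countP_map, ← List.sum_map_count_dedup_filter_eq_countP]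
  refine List.dvd_sum fun n hn => ?_
  obtain ⟨a, ha, rfl⟩ := List.mem_map.1 hn
  obtain ⟨hal, hab⟩ : a ∈ l ∧ f a = b := by simpa using ha
  convert even_iff_two_dvd.1 (Nat.not_odd_iff_even.1 (hl a hal hab))

/-- Adds `a` to the formal sum `l` with coefficients in the field with two elements, by adding or
removing one of the copies of `a` at the front of `l`. This makes `toggle a` an involution of
lists, and not only of formal sums. -/
def toggle (a : α) (l : List α) : List α :=
  if Even (l.takeWhile (· == a)).length then a :: l else l.tail

theorem toggle_eq_cons_or_eq_cons_toggle (a : α) (l : List α) :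
    toggle a l = a :: l ∨ l = a :: toggle a l := by
  cases l with
  | nil => simp [toggle]
  | cons b l =>
    by_cases h : b = a
    · by_cases hl : Even (l.takeWhile (· == a)).length <;> simp [toggle, h, hl, Nat.even_add_one]
    · simp [toggle, h]

theorem toggle_toggle (a : α) (l : List α) : toggle a (toggle a l) = l := by
  cases l with
  | nil => simp [toggle]
  | cons b l =>
    by_cases h : b = a
    · by_cases hl : Even (l.takeWhile (· == a)).length <;> simp [toggle, h, hl, Nat.even_add_one]
    · simp [toggle, h, Nat.even_add_one]

theorem mem_of_mem_toggle {a b : α} {l : List α} (h : b ∈ toggle a l) : b = a ∨ b ∈ l := by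
  rcases toggle_eq_cons_or_eq_cons_toggle a l with hl | hl
  · exact List.mem_cons.1 (hl ▸ h)
  · exact .inr (hl ▸ List.mem_cons_of_mem a h)

theorem odd_count_map_toggle {f : α → β} {a : α} {b : β} {l : List α} :
    Odd (((toggle a l).map f).count b) ↔ (Odd ((l.map f).count b) ↔ f a ≠ b) := by
  rcases toggle_eq_cons_or_eq_cons_toggle a l with hl | hl
  · rw [hl, List.map_cons, odd_count_cons]
  · conv_rhs => rw [hl, List.map_cons, odd_count_cons]
    tauto

theorem sameParity_map_toggle {f : α → β} {a : α} {l : List α} {l' : List β} :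
    SameParity ((toggle a l).map f) (toggle (f a) l') ↔ SameParity (l.map f) l' := by
  refine forall_congr' fun b => ?_
  have h := odd_count_map_toggle (f := id) (a := f a) (b := b) (l := l')
  rw [List.map_id, List.map_id] at h
  rw [odd_count_map_toggle, h, id]
  tauto

end Parity

/-! ### From isomorphisms to branches -/

/-- `z = (k, l)` stands for a formal sum, with coefficients in the field with two elements, of nodes
of length `k` that satisfy `S`. -/
def IsLevelSum (S : List ℕ → Prop) (z : ℕ × List (List ℕ)) : Prop :=
  ∀ σ ∈ z.2, σ.length = z.1 ∧ S σ

/-- The relation that holds between a formal sum of nodes and the sum of the restrictions of these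
nodes to the previous level, and that marks `m` by a loop. -/
def RestrictsTo (m z w : ℕ × List (List ℕ)) : Prop :=
  z.1 = w.1 + 1 ∧ SameParity (z.2.map (List.take w.1)) w.2 ∨ z = m ∧ w = m

theorem primrecRel_isLevelSum {α : Type*} [Primcodable α] {R : α → List ℕ → Prop}
    (hR : PrimrecRel R) : PrimrecRel fun a z => IsLevelSum (R a) z :=
  primrecPred_forall_mem (Primrec.snd.comp .snd)
    ((Primrec.eq.comp (Primrec.list_length.comp .snd)
      (Primrec.fst.comp (Primrec.snd.comp .fst))).and (hR.comp (Primrec.fst.comp .fst) .snd))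

theorem primrecRel_restrictsTo (m : ℕ × List (List ℕ)) : PrimrecRel (RestrictsTo m) := by
  have htake : Primrec fun q : (ℕ × List (List ℕ)) × ℕ × List (List ℕ) =>
      q.1.2.map (List.take q.2.1) :=
    Primrec.list_map (Primrec.snd.comp .fst)
      (Primrec.list_take.comp (Primrec.fst.comp (Primrec.snd.comp .fst)) .snd)
  exact ((Primrec.eq.comp (Primrec.fst.comp .fst) (Primrec.succ.comp (Primrec.fst.comp .snd))).and
    (primrecRel_sameParity.comp htake (Primrec.snd.comp .snd))).or
    ((Primrec.eq.comp .fst (.const m)).and (Primrec.eq.comp .snd (.const m)))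

section Translate

variable {S : List ℕ → Prop} {g : ℕ → ℕ}

/-- Adds the initial segment of `g` of length `k` to a formal sum of nodes of length `k`. -/
def translate (g : ℕ → ℕ) (z : ℕ × List (List ℕ)) : ℕ × List (List ℕ) :=
  (z.1, toggle ((List.range z.1).map g) z.2)

theorem translate_translate (g : ℕ → ℕ) (z : ℕ × List (List ℕ)) :
    translate g (translate g z) = z :=
  Prod.ext rfl (toggle_toggle _ _)

theorem IsLevelSum.translate (hg : ∀ k, S ((List.range k).map g)) {z : ℕ × List (List ℕ)}
    (hz : IsLevelSum S z) : IsLevelSum S (translate g z) := by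
  intro σ hσ
  obtain rfl | hσ := mem_of_mem_toggle hσ
  · exact ⟨by simp [LoquaciousHighness.translate], hg z.1⟩
  · exact hz σ hσ

theorem restrictsTo_translate (g : ℕ → ℕ) (m z w : ℕ × List (List ℕ)) :
    RestrictsTo (translate g m) (translate g z) (translate g w) ↔ RestrictsTo m z w := by
  have hinj : Function.Injective (translate g) :=
    Function.LeftInverse.injective (translate_translate g)
  refine or_congr (and_congr_right fun hlevel => ?_) (by rw [hinj.eq_iff, hinj.eq_iff])
  have htake : ((List.range z.1).map g).take w.1 = (List.range w.1).map g :=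
    take_map_range g (hlevel ▸ w.1.le_succ)
  simp only [translate, ← htake, sameParity_map_toggle]

/-- Translation by a branch of `S` moves the mark from the empty sum to the root. -/
def translateRelIso (hg : ∀ k, S ((List.range k).map g)) :
    Subrel (RestrictsTo (0, [])) (IsLevelSum S) ≃r
      Subrel (RestrictsTo (0, [ [] ])) (IsLevelSum S) where
  toFun z := ⟨translate g z, z.2.translate hg⟩
  invFun z := ⟨translate g z, z.2.translate hg⟩
  left_inv z := Subtype.ext (translate_translate g z)
  right_inv z := Subtype.ext (translate_translate g z)
  map_rel_iff' {z w} := restrictsTo_translate g (0, []) z w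

end Translate

section Thread

variable {S : List ℕ → Prop} {t : ℕ → List (List ℕ)}

/-- A coherent sequence of formal sums of nodes satisfying `S`, one on each level, that starts with
the root. -/
structure IsThread (S : List ℕ → Prop) (t : ℕ → List (List ℕ)) : Prop where
  zero : t 0 = [ [] ]
  isLevelSum (k : ℕ) : IsLevelSum S (k, t k)
  sameParity (k : ℕ) : SameParity ((t (k + 1)).map (List.take k)) (t k)

theorem isThread_of_relIso {F : ℕ × List (List ℕ) → ℕ × List (List ℕ)}
    (e : Subrel (RestrictsTo (0, [])) (IsLevelSum S) ≃r
      Subrel (RestrictsTo (0, [ [] ])) (IsLevelSum S)) (he : ∀ z, (e z : ℕ × List (List ℕ)) = F z) :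
    IsThread S fun k => (F (k, [])).2 := by
  let z (k : ℕ) : Subtype (IsLevelSum S) := ⟨(k, []), by simp [IsLevelSum]⟩
  have hF (k : ℕ) : F (k, []) = e (z k) := (he (z k)).symm
  have hroot : F (0, []) = (0, [ [] ]) := by
    have hloop : Subrel (RestrictsTo (0, [])) (IsLevelSum S) (z 0) (z 0) := .inr ⟨rfl, rfl⟩
    rcases e.map_rel_iff.2 hloop with ⟨hlevel, -⟩ | ⟨hmark, -⟩
    · omega
    · rw [hF, hmark]
  have hstep (k : ℕ) : (F (k + 1, [])).1 = (F (k, [])).1 + 1 ∧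
      SameParity ((F (k + 1, [])).2.map (List.take (F (k, [])).1)) (F (k, [])).2 := by
    have hrestricts : Subrel (RestrictsTo (0, [])) (IsLevelSum S) (z (k + 1)) (z k) :=
      .inl ⟨rfl, fun _ => Iff.rfl⟩
    rcases e.map_rel_iff.2 hrestricts with hlevel | ⟨hmark, -⟩
    · rw [hF, hF]; exact hlevel
    · have : z (k + 1) = z 0 := e.injective (Subtype.ext (hmark.trans (hroot.symm.trans (hF 0))))
      exact absurd (congrArg (fun x => x.1.1) this) k.succ_ne_zero
  have hlevel (k : ℕ) : (F (k, [])).1 = k := by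
    induction k with
    | zero => rw [hroot]
    | succ k ih => rw [(hstep k).1, ih]
  refine ⟨by rw [hroot], fun k => ?_, fun k => by simpa [hlevel] using (hstep k).2⟩
  have h := (e (z k)).2
  rw [← hF] at h
  simpa [IsLevelSum, hlevel] using h

/-- The first node in `l` that extends the node `σ` of length `k` and has odd multiplicity. -/
def oddExtension (k : ℕ) (σ : List ℕ) (l : List (List ℕ)) : List ℕ :=
  (l.filter fun τ => τ.take k = σ ∧ Odd (l.count τ)).headI

theorem headI_mem {α : Type*} [Inhabited α] : ∀ {l : List α}, l ≠ [] → l.headI ∈ l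
  | _ :: _, _ => List.mem_cons_self

theorem oddExtension_spec {k : ℕ} {σ : List ℕ} {l l' : List (List ℕ)}
    (h : SameParity (l.map (List.take k)) l') (hσ : Odd (l'.count σ)) :
    (oddExtension k σ l).take k = σ ∧ Odd (l.count (oddExtension k σ l)) := by
  obtain ⟨τ, hτ, hτσ, hodd⟩ := exists_odd_count_of_odd_count_map ((h σ).2 hσ)
  have hne : l.filter (fun τ => τ.take k = σ ∧ Odd (l.count τ)) ≠ [] :=
    List.ne_nil_of_mem (List.mem_filter.2 ⟨hτ, by simpa using ⟨hτσ, hodd⟩⟩)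
  exact of_decide_eq_true (List.mem_filter.1 (headI_mem hne)).2

/-- The nodes obtained by following odd multiplicities along `t` from the root. -/
def oddNode (t : ℕ → List (List ℕ)) (k : ℕ) : List ℕ :=
  Nat.rec [] (fun k σ => oddExtension k σ (t (k + 1))) k

/-- The branch through the nodes `oddNode t k`. -/
def oddBranch (t : ℕ → List (List ℕ)) (n : ℕ) : ℕ := (oddNode t (n + 1)).getD n 0

theorem IsThread.odd_count_oddNode (ht : IsThread S t) (k : ℕ) :
    Odd ((t k).count (oddNode t k)) := by
  induction k with
  | zero => simp [ht.zero, oddNode]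
  | succ k ih => exact (oddExtension_spec (ht.sameParity k) ih).2

theorem IsThread.take_oddNode (ht : IsThread S t) (k : ℕ) :
    (oddNode t (k + 1)).take k = oddNode t k :=
  (oddExtension_spec (ht.sameParity k) (ht.odd_count_oddNode k)).1

theorem IsThread.oddNode_mem (ht : IsThread S t) (k : ℕ) : oddNode t k ∈ t k :=
  List.count_pos_iff.1 (ht.odd_count_oddNode k).pos

theorem IsThread.map_oddBranch (ht : IsThread S t) (k : ℕ) :
    (List.range k).map (oddBranch t) = oddNode t k := by
  induction k with
  | zero => rfl
  | succ k ih =>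
    have hlen : (oddNode t (k + 1)).length = k + 1 :=
      (ht.isLevelSum (k + 1) _ (ht.oddNode_mem (k + 1))).1
    rw [List.range_succ, List.map_append, ih, List.map_singleton, oddBranch,
      List.getD_eq_getElem _ _ (by omega), ← ht.take_oddNode, List.take_append_getElem (by omega),
      List.take_of_length_le hlen.le]

theorem IsThread.isBranch_oddBranch (ht : IsThread S t) (k : ℕ) :
    S ((List.range k).map (oddBranch t)) :=
  ht.map_oddBranch k ▸ (ht.isLevelSum k _ (ht.oddNode_mem k)).2

end Thread

theorem primrec_oddExtension :
    Primrec fun q : ℕ × List ℕ × List (List ℕ) => oddExtension q.1 q.2.1 q.2.2 := by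
  have hcount : Primrec₂ fun (τ : List ℕ) (q : ℕ × List ℕ × List (List ℕ)) => q.2.2.count τ :=
    primrec₂_count.comp (Primrec.snd.comp (Primrec.snd.comp .snd)) .fst
  have hextends : PrimrecRel fun (τ : List ℕ) (q : ℕ × List ℕ × List (List ℕ)) =>
      τ.take q.1 = q.2.1 ∧ Odd (q.2.2.count τ) :=
    (Primrec.eq.comp (Primrec.list_take.comp (Primrec.fst.comp .snd) .fst)
      (Primrec.fst.comp (Primrec.snd.comp .snd))).and (primrecPred_odd hcount)
  exact Primrec.list_headI.comp (hextends.listFilter.comp (Primrec.snd.comp .snd) .id)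

theorem computableIn_oddExtension {O : Set (ℕ →. ℕ)} {α : Type*} [Primcodable α] {k : α → ℕ}
    {σ : α → List ℕ} {l : α → List (List ℕ)} (hk : ComputableIn O k) (hσ : ComputableIn O σ)
    (hl : ComputableIn O l) : ComputableIn O fun a => oddExtension (k a) (σ a) (l a) :=
  computableIn_comp (f := fun q : ℕ × List ℕ × List (List ℕ) => oddExtension q.1 q.2.1 q.2.2)
    primrec_oddExtension.computableIn (computableIn_pair hk (computableIn_pair hσ hl))

theorem computableIn₂_oddBranch {O : Set (ℕ →. ℕ)} {α : Type*} [Primcodable α]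
    {t : α → ℕ → List (List ℕ)} (ht : ComputableIn₂ O t) :
    ComputableIn₂ O fun a => oddBranch (t a) := by
  have hlevel : ComputableIn O fun p : α × ℕ × List ℕ => t p.1 (p.2.1 + 1) :=
    computableIn_comp₂ ht Primrec.fst.computableIn
      (Primrec.succ.comp (Primrec.fst.comp .snd)).computableIn
  have hnode : ComputableIn₂ O fun a => oddNode (t a) :=
    computableIn₂_nat_rec (h := fun a q => oddExtension q.1 q.2 (t a (q.1 + 1)))
      (Primrec.const []).computableIn
      (computableIn_oddExtension (Primrec.fst.comp .snd).computableIn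
        (Primrec.snd.comp .snd).computableIn hlevel)
  exact computableIn_comp (f := fun q : List ℕ × ℕ => q.1.getD q.2 0)
    (Primrec.list_getD 0).computableIn
    (computableIn_pair (computableIn_comp₂ hnode Primrec.fst.computableIn
      (Primrec.succ.comp .snd).computableIn) Primrec.snd.computableIn)

theorem ComputesIsomorphisms.computesBranches {O : Set (ℕ →. ℕ)} (hO : ComputesIsomorphisms O) :
    ComputesBranches O := by
  intro α _ R hR
  have hmark (m : ℕ × List (List ℕ)) : PrimrecPred
      fun q : α × (ℕ × List (List ℕ)) × (ℕ × List (List ℕ)) => RestrictsTo m q.2.1 q.2.2 :=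
    (primrecRel_restrictsTo m).comp (Primrec.fst.comp .snd) (Primrec.snd.comp .snd)
  obtain ⟨F, hF, hiso⟩ := hO.exists_relIso (Q := fun _ => RestrictsTo (0, []))
    (Q' := fun _ => RestrictsTo (0, [ [] ]))
    (primrecRel_isLevelSum hR) (primrecRel_isLevelSum hR) (hmark (0, [])) (hmark (0, [ [] ]))
  have hthread : ComputableIn₂ O fun a k => (F a (k, [])).2 :=
    computableIn_comp Primrec.snd.computableIn (computableIn_comp₂ hF Primrec.fst.computableIn
      (Primrec.pair .snd (.const [])).computableIn)
  refine ⟨fun a => oddBranch fun k => (F a (k, [])).2, computableIn₂_oddBranch hthread,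
    fun a ⟨g, hg⟩ => ?_⟩
  obtain ⟨e, he⟩ := hiso a ⟨translateRelIso hg⟩
  exact (isThread_of_relIso e he).isBranch_oddBranch

end LoquaciousHighness

theorem mainTheorem3_general (O : Set (ℕ →. ℕ)) :
    LoquaciousHighness.ComputesPaths O ↔ LoquaciousHighness.ComputesIsomorphisms O :=
  ⟨fun h => h.computesBranches.computesIsomorphisms, fun h => h.computesBranches.computesPaths⟩

theorem mainTheorem3 (d : LoquaciousHighness.Degree) :
    LoquaciousHighness.LoquaciouslyHighForPaths d ↔
      LoquaciousHighness.LoquaciouslyHighForIsomorphism d :=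
  exists_congr fun D => and_congr_right fun _ => mainTheorem3_general {LoquaciousHighness.charFun D}
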